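/- Let $k,r,n\ge 0$ be integers, and let $((\mathbb{C}^r)^k)^{\circ}$ be the set of tuples $\overline P=(\overline{m_1},\ldots,\overline{m_k})\in(\mathbb{C}^r)^k$ such that $\sum_{i\in S}\overline{m_i}\neq 0$ for every nonempty $S\subset\{1,\ldots,k\}$. Let $V=\mathbb{C}^n$, and for $v_1,\ldots,v_k\in V$, $1\le j\le r$ and $d\ge 1$ let $$e_d^{(j)}(\overline P,v)=\sum_{i_1+\cdots+i_k=d}\binom{(\overline{m_1})_j}{i_1}\cdots\binom{(\overline{m_k})_j}{i_k}\,v_1^{i_1}\cdots v_k^{i_k}\in \operatorname{Sym}^d V ,$$ so that $(-1)^d e^{(j)}_d(\overline P,v)$, $d\geq 1$, are the coefficients of the formal series $\prod_{i}(z-v_i)^{(\overline{m_i})_j}$. Call $N\ge 0$ stable if the coordinates of $e^{(j)}_d$ with $d>N$ carry no additional information, in the following sense: $((\mathbb{C}^r)^k)^{\circ}$ is covered by basic affine open subsets $D(h)$ of $(\mathbb{C}^r)^k$ over each of which every coordinate of every $e^{(j)}_d$, $d\ge 1$, $1\le j\le r$, is a polynomial, with coefficients in the coordinate ring of $D(h)$,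 in the coordinates of the $e^{(j')}_{d'}$ with $1\le d'\le N$, $1\le j'\le r$. For a Zariski closed subset $X\subset V=\mathbb{A}^n$ and a stable $N$, the space $\Delta^{k,r}(X)$ is the image of the map $$\Phi_X:((\mathbb{C}^r)^k)^{\circ}\times X^k\to((\mathbb{C}^r)^k)^{\circ}\times\Bigl(\prod_{d=1}^{N}\operatorname{Sym}^dV\Bigr)^r,\qquad (\overline P,x)\mapsto\bigl(\overline P,((-1)^de^{(j)}_d(\overline P,x))_{j,d}\bigr).$$ Stable $N$ exist. Moreover, for every stable $N$ and every Zariski closed $X\subset\mathbb{A}^n$, in the Euclidean topology $\Phi_X$ induces a homeomorphism $$\bigl(((\mathbb{C}^r)^k)^{\circ}\times X^k\bigr)/\!\sim\;\xrightarrow{\ \cong\ }\;\Delta^{k,r}(X)$$ (in particular one over $((\mathbb{C}^r)^k)^{\circ}$). Here the left side carries the quotient topology and the right side the subspace topology, and $(\overline{m_1},\ldots,\overline{m_k},x_1,\ldots,x_k)\sim(\overline{m_1},\ldots,\overline{m_k},x'_1,\ldots,x'_k)$ if and only if for every $x\in X$ $$\sum_{i:\,x_i=x}\overline{m_i}=\sum_{i:\,x'_i=x}\overline{m_i}.$$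 -/

import Mathlib

open Topology

noncomputable section

namespace IncidenceStrata

/-- The space `((ℂ^r)^k)°` of allowable weights `(m₁, …, m_k)`, `m_i ∈ ℂ^r`: no nonempty
subfamily of the weights sums to zero. -/
def weightSpace (k r : ℕ) : Set (Fin k → Fin r → ℂ) :=
  {P | ∀ S : Finset (Fin k), S.Nonempty → ∑ i ∈ S, P i ≠ 0}

/-- An affine variety embedded in `𝔸ⁿ`, identified with its set of complex points:
a Zariski closed subset of `ℂⁿ`. Its Euclidean topology is the subspace topology. -/
def IsAffineVariety {n : ℕ} (X : Set (Fin n → ℂ)) : Prop :=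
  ∃ I : Ideal (MvPolynomial (Fin n) ℂ), X = MvPolynomial.zeroLocus ℂ I

/-! ### The topological model -/

open Classical in
/-- The total weight of the configuration `(m₁, …, m_k, x₁, …, x_k)` at the point `p`. -/
def weightAt {k r : ℕ} {X : Type*} (P : Fin k → Fin r → ℂ) (x : Fin k → X) (p : X) :
    Fin r → ℂ :=
  ∑ i with x i = p, P i

/-- Two configurations with the same weights `(m₁, …, m_k)` are equivalent when the total weights
of both agree at every point of `X`. -/
def configSetoid (k r : ℕ) (X : Type*) : Setoid (weightSpace k r × (Fin k → X)) where
  r a b := a.1 = b.1 ∧ ∀ p : X, weightAt a.1.1 a.2 p = weightAt b.1.1 b.2 p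
  iseqv :=
    { refl := fun _ => ⟨rfl, fun _ => rfl⟩
      symm := fun h => ⟨h.1.symm, fun p => (h.2 p).symm⟩
      trans := fun h h' => ⟨h.1.trans h'.1, fun p => (h.2 p).trans (h'.2 p)⟩ }

/-- The family of weighted configuration spaces `(((ℂ^r)^k)° × X^k)/∼`, with the quotient
topology. -/
abbrev WeightedConfigSpace (k r : ℕ) (X : Type*) : Type _ :=
  Quotient (configSetoid k r X)

/-! ### The variety -/

/-- The weighted elementary symmetric polynomial
`e_d(y₁, …, y_k, x₁, …, x_k) = ∑_{i₁ + ⋯ + i_k = d} ∏ⱼ (yⱼ choose iⱼ) xⱼ^{iⱼ}`, with complex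
weights `yⱼ` and with `xⱼ` in a commutative `ℂ`-algebra. -/
def weightedESymm {k : ℕ} {A : Type*} [CommRing A] [Algebra ℂ A] (d : ℕ)
    (y : Fin k → ℂ) (x : Fin k → A) : A :=
  ∑ a ∈ Finset.piAntidiag (Finset.univ : Finset (Fin k)) d,
    ∏ j, (Ring.choose (y j) (a j)) • x j ^ a j

/-- The vector `v ∈ V = ℂⁿ` as an element of `Sym¹ V ⊂ Sym V = ℂ[X₁, …, X_n]`. -/
def linForm {n : ℕ} (v : Fin n → ℂ) : MvPolynomial (Fin n) ℂ :=
  ∑ l, MvPolynomial.C (v l) * MvPolynomial.X l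

/-- With `d = |μ|`, the coordinate along the monomial `X^μ` of the coefficient
`(-1)^d e_d((m₁)_j, …, (m_k)_j, v₁, …, v_k) ∈ Sym^d V` of the formal series
`∏ᵢ (z - vᵢ)^{(mᵢ)_j}`. -/
def chowCoeff {k r n : ℕ} (P : Fin k → Fin r → ℂ) (v : Fin k → Fin n → ℂ)
    (j : Fin r) (μ : Fin n →₀ ℕ) : ℂ :=
  (-1) ^ μ.degree *
    MvPolynomial.coeff μ
      (weightedESymm μ.degree (fun i => P i j) (fun i => linForm (v i)))

/-- Exponents of the monomials in `n` variables of degree `1, …, N`: they index a basis of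
`V × Sym² V × ⋯ × Sym^N V`. -/
abbrev Exponents (n N : ℕ) : Type :=
  {μ : Fin n →₀ ℕ // 1 ≤ μ.degree ∧ μ.degree ≤ N}

/-- The coordinates of a configuration in `(V × Sym² V × ⋯ × Sym^N V)^r`. -/
def chowCoords {k r n : ℕ} (N : ℕ) (P : Fin k → Fin r → ℂ) (v : Fin k → Fin n → ℂ) :
    Fin r → Exponents n N → ℂ :=
  fun j μ => chowCoeff P v j μ.1

/-- The map `((ℂ^r)^k)° × X^k → ((ℂ^r)^k)° × (V × Sym² V × ⋯ × Sym^N V)^r`. -/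
def chowMap (k r : ℕ) {n : ℕ} (N : ℕ) (X : Set (Fin n → ℂ))
    (c : weightSpace k r × (Fin k → X)) :
    weightSpace k r × (Fin r → Exponents n N → ℂ) :=
  (c.1, chowCoords N c.1.1 (fun i => (c.2 i : Fin n → ℂ)))

/-- `N` is large enough that discarding `Sym^d V` for `d > N` loses no information, that is, the
images obtained from `V^k` for any two truncations `N', N'' ≥ N` are isomorphic by projection:
`((ℂ^r)^k)°` is covered by basic affine opens `D(h)` of `(ℂ^r)^k` over which every
coordinate of positive degree is a polynomial in the coordinates of degree `≤ N`, with
coefficients in the ring `ℂ[m][1/h]` of functions on `D(h)`. -/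
def IsStableLevel (k r n N : ℕ) : Prop :=
  ∀ P₀ ∈ weightSpace k r, ∃ h : MvPolynomial (Fin k × Fin r) ℂ,
    MvPolynomial.eval (fun q => P₀ q.1 q.2) h ≠ 0 ∧
    (∀ P : Fin k → Fin r → ℂ,
      MvPolynomial.eval (fun q => P q.1 q.2) h ≠ 0 → P ∈ weightSpace k r) ∧
    ∀ (j : Fin r) (μ : Fin n →₀ ℕ), 1 ≤ μ.degree →
      ∃ (s : ℕ) (F : MvPolynomial ((Fin k × Fin r) ⊕ (Fin r × Exponents n N)) ℂ),
        ∀ P : Fin k → Fin r → ℂ, MvPolynomial.eval (fun q => P q.1 q.2) h ≠ 0 →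
          ∀ v : Fin k → Fin n → ℂ,
            chowCoeff P v j μ =
              MvPolynomial.eval
                (Sum.elim (fun q => P q.1 q.2) (fun q => chowCoords N P v q.1 q.2)) F /
                (MvPolynomial.eval (fun q => P q.1 q.2) h) ^ s

/-- `Δ^{k,r}(X)` for `X ⊂ 𝔸ⁿ`, as the image of `((ℂ^r)^k)° × X^k` in
`((ℂ^r)^k)° × (V × Sym² V × ⋯ × Sym^N V)^r` (`N` being a stable level). Its Euclidean topology is
the subspace topology. -/
def Delta (k r : ℕ) {n : ℕ} (N : ℕ) (X : Set (Fin n → ℂ)) :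
    Set (weightSpace k r × (Fin r → Exponents n N → ℂ)) :=
  Set.range (chowMap k r N X)

end IncidenceStrata

end

/-! The logarithmic derivative of `∏ (1 + xᵢ t)^{yᵢ}` is `∑ yᵢ xᵢ / (1 + xᵢ t)`, so Newton's
identities hold for complex weights and the `e_d` and the weighted power sums determine each other
polynomially (`newton`). Power sums in a domain detect the total weight at each nonzero point, by
pairing with a polynomial that vanishes at the other points (`sum_weights_eq_zero`). This fact is
used twice.

Stable levels: modulo a prime containing all power sums, a nonzero variable would give a subfamily
of weights with sum zero. So over `D(h)`, where suitable subset sums are invertible, the variables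
are nilpotent modulo the power sums, and the points are integral over the algebra of the `e_d`
(`isIntegral_of_pSum_mem`). By Artin-Tate that algebra is finitely generated (`chowAlgebra_fg`), so
finitely many degrees suffice.

Homeomorphism: in `ℂ[X₁, …, X_n]` the same fact identifies the fibres with the equivalence classes
(`chowMap_eq_iff`). The map is proper: rescaling an unbounded family to the unit sphere would
produce a nonzero configuration with all coordinates zero. A proper map is closed, hence a quotient
map onto its image. -/

namespace IncidenceStrata

open Finset

/-! ### Newton's identities with complex weights -/

section Newton

variable {k : ℕ} {A : Type*} [CommRing A] [Algebra ℂ A]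

/-- The weighted power sum `∑ᵢ yᵢ xᵢ^d`. -/
noncomputable def weightedPSum (d : ℕ) (y : Fin k → ℂ) (x : Fin k → A) : A :=
  ∑ i, y i • x i ^ d

/-- The binomial series `(1 + x t)^y`. -/
noncomputable def binomSeries (y : ℂ) (x : A) : PowerSeries A :=
  PowerSeries.mk fun a => Ring.choose y a • x ^ a

/-- The logarithmic derivative `y x / (1 + x t)` of `(1 + x t)^y`. -/
noncomputable def logDerivSeries (y : ℂ) (x : A) : PowerSeries A :=
  PowerSeries.mk fun a => (-1) ^ a * y • x ^ (a + 1)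

lemma succ_mul_choose_succ (y : ℂ) (a : ℕ) :
    ((a : ℂ) + 1) * Ring.choose y (a + 1) = (y - a) * Ring.choose y a := by
  have h1 := Ring.descPochhammer_eq_factorial_smul_choose y (a + 1)
  have h0 := Ring.descPochhammer_eq_factorial_smul_choose y a
  rw [descPochhammer_succ_right, Polynomial.smeval_mul, h0, Nat.factorial_succ] at h1
  have hf : (a.factorial : ℂ) ≠ 0 := by exact_mod_cast a.factorial_ne_zero
  simp only [Polynomial.smeval_sub, Polynomial.smeval_X, pow_one, nsmul_eq_mul,
    Polynomial.smeval_natCast, pow_zero, mul_one, Nat.cast_mul, Nat.cast_add, Nat.cast_one] at h1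
  apply mul_left_cancel₀ hf
  linear_combination -h1

/-- After multiplication by the unit `1 + x t` the equation becomes `(1 + x t) f' = y x f`, whose
coefficients are the recursion `succ_mul_choose_succ`. -/
lemma derivative_binomSeries (y : ℂ) (x : A) :
    PowerSeries.derivative A (binomSeries y x) = logDerivSeries y x * binomSeries y x := by
  have hu : IsUnit (1 + PowerSeries.C x * PowerSeries.X : PowerSeries A) := by
    rw [PowerSeries.isUnit_iff_constantCoeff]; simp
  apply hu.mul_left_cancel
  have hL : (1 + PowerSeries.C x * PowerSeries.X) * logDerivSeries y x =
      PowerSeries.C (y • x) := by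
    ext (_ | n)
    · simp [logDerivSeries]
    · simp only [add_mul, one_mul, mul_assoc, map_add, PowerSeries.coeff_C_mul,
        PowerSeries.coeff_succ_X_mul, logDerivSeries, PowerSeries.coeff_mk, PowerSeries.coeff_C,
        Algebra.smul_def]
      simp; ring
  rw [← mul_assoc, hL]
  ext (_ | n)
  · have h0 := PowerSeries.coeff_derivative (binomSeries y x) 0
    rw [PowerSeries.coeff_zero_eq_constantCoeff_apply] at h0
    simp only [PowerSeries.coeff_zero_eq_constantCoeff_apply, map_mul, h0]
    simp [binomSeries]
  · have h := congrArg (algebraMap ℂ A) (succ_mul_choose_succ y (n + 1))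
    simp only [map_mul, map_add, map_sub, map_one, map_natCast] at h
    simp only [add_mul, one_mul, mul_assoc, map_add, PowerSeries.coeff_C_mul,
      PowerSeries.coeff_succ_X_mul, PowerSeries.coeff_derivative, binomSeries,
      PowerSeries.coeff_mk, Algebra.smul_def]
    push_cast at h ⊢
    linear_combination x ^ (n + 2) * h

lemma derivative_prod_binomSeries (y : Fin k → ℂ) (x : Fin k → A) (s : Finset (Fin k)) :
    PowerSeries.derivative A (∏ i ∈ s, binomSeries (y i) (x i)) =
      (∑ i ∈ s, logDerivSeries (y i) (x i)) * ∏ i ∈ s, binomSeries (y i) (x i) := by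
  induction s using Finset.induction_on with
  | empty => simp
  | insert a s ha ih =>
    rw [prod_insert ha, sum_insert ha, Derivation.leibniz, ih, derivative_binomSeries]
    simp only [smul_eq_mul]
    ring

lemma coeff_prod_binomSeries (y : Fin k → ℂ) (x : Fin k → A) (d : ℕ) :
    PowerSeries.coeff d (∏ i, binomSeries (y i) (x i)) = weightedESymm d y x := by
  rw [PowerSeries.coeff_prod, weightedESymm]
  refine Finset.sum_bij (fun f _ => ⇑f) ?_ ?_ ?_ ?_
  · intro f hf
    simpa [mem_piAntidiag] using (mem_finsuppAntidiag.1 hf).1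
  · intro f _ g _ h
    exact DFunLike.coe_injective h
  · intro f hf
    refine ⟨Finsupp.equivFunOnFinite.symm f, ?_, by simp⟩
    simpa [mem_finsuppAntidiag] using (mem_piAntidiag.1 hf).1
  · intro f _
    simp [binomSeries]

/-- Newton's identities for the weighted elementary symmetric polynomials. -/
lemma newton (y : Fin k → ℂ) (x : Fin k → A) (d : ℕ) :
    ((d : A) + 1) * weightedESymm (d + 1) y x =
      ∑ q ∈ antidiagonal d, (-1) ^ q.1 * weightedPSum (q.1 + 1) y x * weightedESymm q.2 y x := by
  have h := congrArg (PowerSeries.coeff d) (derivative_prod_binomSeries y x univ)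
  rw [PowerSeries.coeff_derivative, coeff_prod_binomSeries, PowerSeries.coeff_mul] at h
  rw [mul_comm, h]
  refine sum_congr rfl fun q _ => ?_
  rw [coeff_prod_binomSeries, map_sum, weightedPSum, mul_sum]
  simp [logDerivSeries]

lemma weightedESymm_zero (y : Fin k → ℂ) (x : Fin k → A) : weightedESymm 0 y x = 1 := by
  rw [← coeff_prod_binomSeries, PowerSeries.coeff_zero_eq_constantCoeff_apply, map_prod]
  refine prod_eq_one fun i _ => ?_
  rw [← PowerSeries.coeff_zero_eq_constantCoeff_apply]
  simp [binomSeries]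

lemma weightedESymm_smul (y : Fin k → ℂ) (x : Fin k → A) (c : ℂ) (d : ℕ) :
    weightedESymm d y (fun i => c • x i) = c ^ d • weightedESymm d y x := by
  simp only [weightedESymm, smul_sum]
  refine sum_congr rfl fun a ha => ?_
  rw [← (mem_piAntidiag.1 ha).1, ← prod_pow_eq_pow_sum, ← prod_smul]
  refine prod_congr rfl fun i _ => ?_
  rw [smul_pow, smul_comm]

/-- Newton's identities solved for the top elementary symmetric polynomial. -/
lemma weightedESymm_succ (y : Fin k → ℂ) (x : Fin k → A) (d : ℕ) :
    weightedESymm (d + 1) y x = ((d : ℂ) + 1)⁻¹ •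
      ∑ q ∈ antidiagonal d, (-1) ^ q.1 * weightedPSum (q.1 + 1) y x * weightedESymm q.2 y x := by
  rw [← newton, eq_inv_smul_iff₀ (by exact_mod_cast d.succ_ne_zero), Algebra.smul_def]
  simp

/-- Newton's identities solved for the top power sum. -/
lemma weightedPSum_succ (y : Fin k → ℂ) (x : Fin k → A) (d : ℕ) :
    weightedPSum (d + 1) y x = (-1) ^ d * (((d : ℂ) + 1) • weightedESymm (d + 1) y x -
      ∑ a ∈ range d, (-1) ^ a * weightedPSum (a + 1) y x * weightedESymm (d - a) y x) := by
  have h := newton y x d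
  -- The last term, with factor `e_0 = 1`, contains the top power sum.
  rw [Nat.sum_antidiagonal_eq_sum_range_succ_mk, sum_range_succ, Nat.sub_self,
    weightedESymm_zero] at h
  have h2 : ((d : ℂ) + 1) • weightedESymm (d + 1) y x =
      ((d : A) + 1) * weightedESymm (d + 1) y x := by
    rw [Algebra.smul_def]; simp
  rw [h2, h, add_sub_cancel_left, mul_one, ← mul_assoc, ← mul_pow]
  simp

end Newton

/-! ### Newton's identities inside an algebra of functions -/

section CoeffMem

variable {Ω σ : Type*}

/-- All coefficients of a family of polynomials lie in a given algebra of functions. -/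
def CoeffMem (S : Subalgebra ℂ (Ω → ℂ)) (f : Ω → MvPolynomial σ ℂ) : Prop :=
  ∀ ν, (fun ω => MvPolynomial.coeff ν (f ω)) ∈ S

variable {S : Subalgebra ℂ (Ω → ℂ)} {f g : Ω → MvPolynomial σ ℂ}

lemma CoeffMem.const (p : MvPolynomial σ ℂ) : CoeffMem S fun _ => p :=
  fun ν => S.algebraMap_mem (MvPolynomial.coeff ν p)

lemma CoeffMem.add (hf : CoeffMem S f) (hg : CoeffMem S g) : CoeffMem S fun ω => f ω + g ω :=
  fun ν => by simpa using! S.add_mem (hf ν) (hg ν)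

lemma CoeffMem.sub (hf : CoeffMem S f) (hg : CoeffMem S g) : CoeffMem S fun ω => f ω - g ω :=
  fun ν => by simpa using! S.sub_mem (hf ν) (hg ν)

lemma CoeffMem.sum {ι : Type*} {s : Finset ι} {f : ι → Ω → MvPolynomial σ ℂ}
    (hf : ∀ i ∈ s, CoeffMem S (f i)) : CoeffMem S fun ω => ∑ i ∈ s, f i ω := by
  intro ν
  have := S.sum_mem fun i hi => hf i hi ν
  convert this using 1
  ext ω
  simp [MvPolynomial.coeff_sum]

lemma CoeffMem.mul (hf : CoeffMem S f) (hg : CoeffMem S g) :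
    CoeffMem S fun ω => f ω * g ω := by
  classical
  intro ν
  have := S.sum_mem fun (q : (σ →₀ ℕ) × (σ →₀ ℕ)) (_ : q ∈ antidiagonal ν) =>
    S.mul_mem (hf q.1) (hg q.2)
  convert this using 1
  ext ω
  simp [MvPolynomial.coeff_mul]

lemma CoeffMem.pow (hf : CoeffMem S f) (d : ℕ) : CoeffMem S fun ω => f ω ^ d := by
  induction d with
  | zero => simpa using CoeffMem.const 1
  | succ d ih => simpa only [pow_succ] using ih.mul hf

lemma CoeffMem.C {a : Ω → ℂ} (ha : a ∈ S) :
    CoeffMem S fun ω => (MvPolynomial.C (a ω) : MvPolynomial σ ℂ) := by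
  classical
  intro ν
  by_cases h : 0 = ν
  · simpa [MvPolynomial.coeff_C, h] using ha
  · simp only [MvPolynomial.coeff_C, h, if_false]
    exact S.zero_mem

lemma CoeffMem.smul {a : Ω → ℂ} (ha : a ∈ S) (hf : CoeffMem S f) :
    CoeffMem S fun ω => a ω • f ω := by
  simpa only [MvPolynomial.smul_eq_C_mul] using (CoeffMem.C ha).mul hf

variable {k : ℕ} {y : Ω → Fin k → ℂ} {x : Ω → Fin k → MvPolynomial σ ℂ}

/-- The power sums determine the elementary symmetric polynomials. -/
lemma CoeffMem.weightedESymm (h : ∀ d, CoeffMem S fun ω => weightedPSum (d + 1) (y ω) (x ω))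
    (d : ℕ) : CoeffMem S fun ω => IncidenceStrata.weightedESymm d (y ω) (x ω) := by
  induction d using Nat.strong_induction_on with
  | _ d ih =>
    obtain _ | d := d
    · simpa only [weightedESymm_zero] using CoeffMem.const 1
    · simp only [weightedESymm_succ]
      refine CoeffMem.smul (S.algebraMap_mem _) (CoeffMem.sum fun q hq => ?_)
      refine (((CoeffMem.const _).pow _).mul (h _)).mul (ih _ ?_)
      have := mem_antidiagonal.1 hq
      omega

/-- The elementary symmetric polynomials determine the power sums. -/
lemma CoeffMem.weightedPSum
    (h : ∀ d, CoeffMem S fun ω => IncidenceStrata.weightedESymm (d + 1) (y ω) (x ω))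
    (d : ℕ) : CoeffMem S fun ω => IncidenceStrata.weightedPSum (d + 1) (y ω) (x ω) := by
  induction d using Nat.strong_induction_on with
  | _ d ih =>
    rw [funext fun ω => weightedPSum_succ (y ω) (x ω) d]
    refine ((CoeffMem.const _).pow _).mul (CoeffMem.sub (CoeffMem.smul (S.algebraMap_mem _) (h d))
      (CoeffMem.sum fun a ha => ?_))
    have ha := mem_range.1 ha
    refine (((CoeffMem.const _).pow _).mul (ih a ha)).mul ?_
    obtain ⟨b, hb⟩ : ∃ b, d - a = b + 1 := ⟨d - a - 1, by omega⟩
    simpa only [hb] using h b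

end CoeffMem

/-! ### Mutual determination at a single configuration -/

section Determine

variable {k : ℕ} {A : Type*} [CommRing A] [Algebra ℂ A] {y y' : Fin k → ℂ} {x x' : Fin k → A}

lemma weightedESymm_congr (h : ∀ d, weightedPSum (d + 1) y x = weightedPSum (d + 1) y' x')
    (d : ℕ) : weightedESymm d y x = weightedESymm d y' x' := by
  induction d using Nat.strong_induction_on with
  | _ d ih =>
    obtain _ | d := d
    · simp only [weightedESymm_zero]
    · simp only [weightedESymm_succ]
      congr 1
      refine sum_congr rfl fun q hq => ?_
      have := mem_antidiagonal.1 hq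
      rw [h, ih _ (by omega)]

lemma weightedPSum_congr (h : ∀ d, weightedESymm (d + 1) y x = weightedESymm (d + 1) y' x')
    (d : ℕ) : weightedPSum (d + 1) y x = weightedPSum (d + 1) y' x' := by
  induction d using Nat.strong_induction_on with
  | _ d ih =>
    rw [weightedPSum_succ, weightedPSum_succ y', h]
    congr 2
    refine sum_congr rfl fun a ha => ?_
    have ha := mem_range.1 ha
    obtain ⟨b, hb⟩ : ∃ b, d - a = b + 1 := ⟨d - a - 1, by omega⟩
    rw [ih a ha, hb, h]

end Determine

/-! ### Recovering weights from power sums -/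

section Domain

variable {ι D : Type*} [Fintype ι] [CommRing D] [IsDomain D] [DecidableEq D]

/-- A weighted family of points of a domain all of whose power sums vanish has total weight zero
at every point. -/
lemma sum_weights_eq_zero (w x : ι → D) (h : ∀ d : ℕ, ∑ i, w i * x i ^ d = 0) (z : D) :
    ∑ i with x i = z, w i = 0 := by
  -- `g` vanishes at every point of the family except `z`, so pairing it with the weights isolates
  -- the total weight at `z`.
  let g : Polynomial D := ∏ q ∈ (univ.image x).erase z, (Polynomial.X - Polynomial.C q)
  have hg : ∀ p : Polynomial D, ∑ i, w i * p.eval (x i) = 0 := by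
    intro p
    simp only [Polynomial.eval_eq_sum_range, mul_sum]
    rw [sum_comm]
    refine sum_eq_zero fun d _ => ?_
    have := congrArg (p.coeff d * ·) (h d)
    simp only [mul_sum, mul_zero] at this
    rw [← this]
    exact sum_congr rfl fun i _ => by ring
  have hz : g.eval z ≠ 0 := by
    simp only [g, Polynomial.eval_prod, Polynomial.eval_sub, Polynomial.eval_X, Polynomial.eval_C]
    exact prod_ne_zero_iff.2 fun q hq => sub_ne_zero.2 (ne_of_mem_erase hq).symm
  have h0 : ∀ i, x i ≠ z → g.eval (x i) = 0 := by
    intro i hi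
    simp only [g, Polynomial.eval_prod, Polynomial.eval_sub, Polynomial.eval_X, Polynomial.eval_C]
    exact prod_eq_zero (mem_erase.2 ⟨hi, mem_image_of_mem x (mem_univ i)⟩) (sub_self _)
  have h1 : (∑ i with x i = z, w i) * g.eval z = 0 := by
    rw [← hg g, sum_mul, sum_filter]
    refine sum_congr rfl fun i _ => ?_
    split_ifs with hi
    · rw [hi]
    · rw [h0 i hi, mul_zero]
  exact (mul_eq_zero.1 h1).resolve_right hz

/-- The same, with the degree zero power sum unconstrained, at nonzero points. -/
lemma sum_weights_eq_zero_of_ne_zero (w x : ι → D)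
    (h : ∀ d : ℕ, ∑ i, w i * x i ^ (d + 1) = 0) {z : D} (hz : z ≠ 0) :
    ∑ i with x i = z, w i = 0 := by
  -- Absorbing one factor `x i` into the weight makes the degrees start at zero, at the cost of a
  -- factor `z`.
  have h1 := sum_weights_eq_zero (fun i => w i * x i) x
    (fun d => by simpa only [pow_succ', mul_assoc] using h d) z
  have h2 : (∑ i with x i = z, w i) * z = 0 := by
    rw [← h1, sum_mul]
    exact sum_congr rfl fun i hi => by rw [(mem_filter.1 hi).2]
  exact (mul_eq_zero.1 h2).resolve_right hz

end Domain

/-! ### Integrality of the points over the power sums -/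

section Integral

variable {ι κ A : Type*} [Fintype ι] [CommRing A]

open MvPolynomial

/-- The generic weighted power sums, with weights in `A`. -/
noncomputable def genericPSum (w : ι → κ → A) (q : ℕ × κ) : MvPolynomial ι A :=
  ∑ i, C (w i q.2) * X i ^ (q.1 + 1)

lemma genericPSum_isHomogeneous (w : ι → κ → A) (q : ℕ × κ) :
    (genericPSum w q).IsHomogeneous (q.1 + 1) := by
  refine IsHomogeneous.sum _ _ _ fun i _ => ?_
  simpa using (isHomogeneous_C ι (w i q.2)).mul ((isHomogeneous_X A i).pow (q.1 + 1))

/-- If no nonempty family of weights sums to zero anywhere on `Spec A`, the variables are nilpotent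
modulo the power sums. -/
lemma exists_X_pow_mem (w : ι → κ → A)
    (hw : ∀ s : Finset ι, s.Nonempty → ∃ j, IsUnit (∑ i ∈ s, w i j)) (i : ι) :
    ∃ M : ℕ, (X i : MvPolynomial ι A) ^ M ∈ Ideal.span (Set.range (genericPSum w)) := by
  classical
  suffices X i ∈ (Ideal.span (Set.range (genericPSum w))).radical from this
  rw [Ideal.radical_eq_sInf, Ideal.mem_sInf]
  rintro Q ⟨hQ, hp⟩
  by_contra hi
  let f := Ideal.Quotient.mk Q
  have hz : f (X i) ≠ 0 := fun h => hi (Ideal.Quotient.eq_zero_iff_mem.1 h)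
  -- The variables that coincide with `X i` modulo `Q` have total weight zero in every coordinate,
  -- but a unit in coordinate `j`.
  obtain ⟨j, hj⟩ := hw {i' | f (X i') = f (X i)} ⟨i, by simp⟩
  have := sum_weights_eq_zero_of_ne_zero (fun i' => f (C (w i' j))) (fun i' => f (X i'))
    (fun d => by
      have := Ideal.Quotient.eq_zero_iff_mem.2 (hQ (Ideal.subset_span ⟨(d, j), rfl⟩))
      simpa [genericPSum] using! this) hz
  rw [← map_sum, ← map_sum] at this
  exact ((hj.map C).map f).ne_zero this

/-- The `A`-span of products of a power sum with a monomial of degree less than `m`. -/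
noncomputable def lowerSpan (w : ι → κ → A) (m : ℕ) : Submodule A (MvPolynomial ι A) :=
  Submodule.span A {p | ∃ (q : ℕ × κ) (ν : ι →₀ ℕ), ν.degree < m ∧
    p = monomial ν 1 * genericPSum w q}

/-- Each power sum has positive degree, so its monomial multipliers in degree `m` have degree below
`m`. This drop drives the induction in `isIntegral_of_pSum_mem`. -/
lemma homogeneousComponent_mem_lowerSpan (w : ι → κ → A) {f : MvPolynomial ι A}
    (hf : f ∈ Ideal.span (Set.range (genericPSum w))) (m : ℕ) :
    homogeneousComponent m f ∈ lowerSpan w m := by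
  obtain ⟨c, rfl⟩ := Finsupp.mem_ideal_span_range_iff_exists_finsupp.1 hf
  rw [Finsupp.sum, map_sum]
  refine sum_mem fun q _ => ?_
  induction c q using MvPolynomial.induction_on' with
  | add f g hf hg => rw [add_mul, map_add]; exact add_mem hf hg
  | monomial ν a =>
    have ha : monomial ν a * genericPSum w q = a • (monomial ν 1 * genericPSum w q) := by
      rw [← smul_mul_assoc, smul_monomial, smul_eq_mul, mul_one]
    rw [ha, map_smul, homogeneousComponent_of_mem
      ((isHomogeneous_monomial 1 rfl).mul (genericPSum_isHomogeneous w q))]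
    refine Submodule.smul_mem _ _ ?_
    split_ifs with h
    · exact Submodule.subset_span ⟨q, ν, by omega, rfl⟩
    · exact zero_mem _

/-- If the power sums of elements `xᵢ` of an `A`-algebra lie in `A`, and no nonempty family of
weights sums to zero anywhere on `Spec A`, then the `xᵢ` are integral over `A`. -/
lemma isIntegral_of_pSum_mem {B : Type*} [CommRing B] [Algebra A B] (w : ι → κ → A)
    (hw : ∀ s : Finset ι, s.Nonempty → ∃ j, IsUnit (∑ i ∈ s, w i j)) (x : ι → B)
    (hx : ∀ q, aeval x (genericPSum w q) ∈ (algebraMap A B).range) (i : ι) :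
    IsIntegral A (x i) := by
  classical
  choose M hM using exists_X_pow_mem w hw
  let T : Set (ι →₀ ℕ) := {ν | ν.degree ≤ ∑ i, M i}
  let N : Submodule A B := Submodule.span A ((fun ν => aeval x (monomial ν (1 : A))) '' T)
  have key : ∀ d : ℕ, ∀ ν : ι →₀ ℕ, ν.degree = d → aeval x (monomial ν (1 : A)) ∈ N := by
    intro d
    induction d using Nat.strong_induction_on with
    | _ d ih =>
    intro ν hν
    by_cases hd : d ≤ ∑ i, M i
    · exact Submodule.subset_span ⟨ν, by simpa [T, hν] using hd, rfl⟩
    -- By pigeonhole some exponent reaches `M i`. Then `X i ^ M i` is traded for power sums, which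
    -- evaluate into `A`, times monomials of lower degree.
    · obtain ⟨i, hi⟩ : ∃ i, M i ≤ ν i := by
        by_contra! h
        refine hd ?_
        rw [← hν, Finsupp.degree_eq_sum]
        exact sum_le_sum fun i _ => (h i).le
      obtain ⟨ν', rfl⟩ : ∃ ν', ν = ν' + Finsupp.single i (M i) :=
        ⟨ν - Finsupp.single i (M i), (tsub_add_cancel_of_le (by simpa using hi)).symm⟩
      have hmem : (X i : MvPolynomial ι A) ^ M i ∈ lowerSpan w (M i) := by
        have h := homogeneousComponent_mem_lowerSpan w (hM i) (M i)
        rwa [homogeneousComponent_eq_self (by simpa using (isHomogeneous_X A i).pow (M i))] at h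
      have hmul : ∀ p ∈ lowerSpan w (M i), aeval x (monomial ν' (1 : A) * p) ∈ N := by
        intro p hp
        induction hp using Submodule.span_induction with
        | zero => simp
        | add f g _ _ hf hg => rw [mul_add, map_add]; exact add_mem hf hg
        | smul a f _ hf => rw [mul_smul_comm, map_smul]; exact N.smul_mem a hf
        | mem f hf =>
          obtain ⟨q, μ, hμ, rfl⟩ := hf
          obtain ⟨a, ha⟩ := hx q
          rw [← mul_assoc, monomial_mul, one_mul, map_mul, ← ha, mul_comm, ← Algebra.smul_def]
          refine N.smul_mem a (ih _ ?_ _ rfl)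
          rw [← hν, map_add, map_add, Finsupp.degree_single]
          omega
      have := hmul _ hmem
      rwa [X_pow_eq_monomial, monomial_mul, one_mul] at this
  refine IsIntegral.of_mem_of_fg (aeval x : MvPolynomial ι A →ₐ[A] B).range ?_ _ ⟨X i, by simp⟩
  have hN : Subalgebra.toSubmodule (aeval x : MvPolynomial ι A →ₐ[A] B).range = N := by
    apply le_antisymm
    · rintro _ ⟨p, rfl⟩
      induction p using MvPolynomial.induction_on' with
      | add f g hf hg => exact (map_add (aeval x : MvPolynomial ι A →ₐ[A] B) f g) ▸ add_mem hf hg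
      | monomial ν a =>
        have := N.smul_mem a (key _ ν rfl)
        rwa [← map_smul, smul_monomial, smul_eq_mul, mul_one] at this
    · rw [Submodule.span_le]
      rintro _ ⟨ν, _, rfl⟩
      exact ⟨_, rfl⟩
  rw [hN]
  exact Submodule.fg_span ((Finsupp.finite_of_degree_le _).image _)

end Integral

/-! ### Vectors as linear forms -/

section LinForm

variable {n : ℕ}

lemma linForm_isHomogeneous (v : Fin n → ℂ) : (linForm v).IsHomogeneous 1 := by
  refine MvPolynomial.IsHomogeneous.sum _ _ _ fun l _ => ?_
  simpa using (MvPolynomial.isHomogeneous_C _ (v l)).mul (MvPolynomial.isHomogeneous_X ℂ l)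

lemma linForm_smul (c : ℂ) (v : Fin n → ℂ) : linForm (c • v) = c • linForm v := by
  simp [linForm, smul_sum, MvPolynomial.smul_eq_C_mul, mul_assoc]

lemma coeff_single_linForm (v : Fin n → ℂ) (l : Fin n) :
    MvPolynomial.coeff (Finsupp.single l 1) (linForm v) = v l := by
  simp [linForm, MvPolynomial.coeff_sum, MvPolynomial.coeff_C_mul, MvPolynomial.coeff_X,
    Finsupp.single_left_inj]

lemma linForm_injective : Function.Injective (linForm (n := n)) := by
  intro v v' h
  ext l
  rw [← coeff_single_linForm v, h, coeff_single_linForm]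

/-- Reads the scalar power sums of the `l`-th coordinates off the power sums in `Sym^d V`. -/
lemma coeff_single_linForm_pow (v : Fin n → ℂ) (l : Fin n) (d : ℕ) :
    MvPolynomial.coeff (Finsupp.single l d) (linForm v ^ d) = v l ^ d := by
  induction d with
  | zero => simp
  | succ d ih =>
    rw [pow_succ, linForm, mul_sum, MvPolynomial.coeff_sum, Finset.sum_eq_single l]
    · rw [mul_left_comm, MvPolynomial.coeff_C_mul, MvPolynomial.coeff_mul_X', if_pos (by simp),
        ← Finsupp.single_tsub, Nat.add_sub_cancel, ← linForm, ih]
      ring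
    · intro l' _ hl'
      rw [mul_left_comm, MvPolynomial.coeff_C_mul, MvPolynomial.coeff_mul_X', if_neg, mul_zero]
      exact fun h => hl' (by simpa using Finsupp.support_single_subset h)
    · simp

lemma weightedESymm_linForm_isHomogeneous {k : ℕ} (d : ℕ) (y : Fin k → ℂ)
    (v : Fin k → Fin n → ℂ) :
    (weightedESymm d y fun i => linForm (v i)).IsHomogeneous d := by
  refine MvPolynomial.IsHomogeneous.sum _ _ _ fun a ha => ?_
  rw [← (mem_piAntidiag.1 ha).1]
  refine MvPolynomial.IsHomogeneous.prod _ _ _ fun i _ => ?_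
  rw [MvPolynomial.smul_eq_C_mul]
  simpa using (MvPolynomial.isHomogeneous_C _ _).mul ((linForm_isHomogeneous (v i)).pow (a i))

end LinForm

/-! ### Passing between `chowCoeff` and power sums -/

section Coordinates

variable {k r n : ℕ} {Ω : Type*} {S : Subalgebra ℂ (Ω → ℂ)}
  {P : Ω → Fin k → Fin r → ℂ} {v : Ω → Fin k → Fin n → ℂ}

lemma coeffMem_linForm {v : Ω → Fin n → ℂ} (hv : ∀ l, (fun ω => v ω l) ∈ S) :
    CoeffMem S fun ω => linForm (v ω) :=
  CoeffMem.sum fun l _ => (CoeffMem.C (hv l)).mul (CoeffMem.const _)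

/-- The coordinates `chowCoeff` are polynomials in the weights and the points. -/
lemma chowCoeff_mem (hP : ∀ i j, (fun ω => P ω i j) ∈ S) (hv : ∀ i l, (fun ω => v ω i l) ∈ S)
    (j : Fin r) (μ : Fin n →₀ ℕ) : (fun ω => chowCoeff (P ω) (v ω) j μ) ∈ S := by
  have h : ∀ d, CoeffMem S fun ω =>
      weightedPSum (d + 1) (fun i => P ω i j) (fun i => linForm (v ω i)) := fun d =>
    CoeffMem.sum fun i _ => CoeffMem.smul (hP i j) ((coeffMem_linForm (hv i)).pow _)
  exact S.mul_mem (S.algebraMap_mem ((-1) ^ μ.degree)) (CoeffMem.weightedESymm h μ.degree μ)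

lemma coeff_weightedESymm (P : Fin k → Fin r → ℂ) (v : Fin k → Fin n → ℂ) (j : Fin r)
    (d : ℕ) (μ : Fin n →₀ ℕ) :
    MvPolynomial.coeff μ (weightedESymm d (fun i => P i j) fun i => linForm (v i)) =
      if μ.degree = d then (-1) ^ d * chowCoeff P v j μ else 0 := by
  split_ifs with h
  · rw [chowCoeff, h, ← mul_assoc, ← mul_pow]
    simp
  · by_contra h0
    refine h ?_
    rw [Finsupp.degree_eq_weight_one]
    exact weightedESymm_linForm_isHomogeneous d _ v h0

/-- The power sums of the coordinates of the points are polynomials in the `chowCoeff`. -/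
lemma psum_mem (h : ∀ j (μ : Fin n →₀ ℕ), 1 ≤ μ.degree →
    (fun ω => chowCoeff (P ω) (v ω) j μ) ∈ S) (j : Fin r) (l : Fin n) (d : ℕ) :
    (fun ω => ∑ i, P ω i j * v ω i l ^ (d + 1)) ∈ S := by
  have he : ∀ d, CoeffMem S fun ω =>
      weightedESymm (d + 1) (fun i => P ω i j) (fun i => linForm (v ω i)) := by
    intro d μ
    simp only [coeff_weightedESymm]
    split_ifs with hd
    · exact S.mul_mem (S.algebraMap_mem ((-1) ^ (d + 1))) (h j μ (by omega))
    · exact S.zero_mem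
  convert CoeffMem.weightedPSum he d (Finsupp.single l (d + 1)) using 2 with ω
  simp only [weightedPSum, MvPolynomial.coeff_sum, MvPolynomial.coeff_smul,
    coeff_single_linForm_pow, smul_eq_mul]

end Coordinates

/-! ### Existence of stable levels -/

section Stable

variable {k r n : ℕ}

/-- The pairs of weights `P` with `h(P) ≠ 0` and points of `V^k`. -/
abbrev BasicOpen (n : ℕ) (h : MvPolynomial (Fin k × Fin r) ℂ) : Type :=
  {ω : (Fin k → Fin r → ℂ) × (Fin k → Fin n → ℂ) //
    MvPolynomial.eval (fun q => ω.1 q.1 q.2) h ≠ 0}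

variable (h : MvPolynomial (Fin k × Fin r) ℂ)

/-- Generators of the coordinate ring of `D(h)`, as functions on `D(h) × V^k`. -/
def baseGenerators (n : ℕ) : Set (BasicOpen n h → ℂ) :=
  Set.range (fun q : Fin k × Fin r => fun ω => ω.1.1 q.1 q.2) ∪
    {fun ω => (MvPolynomial.eval (fun q => ω.1.1 q.1 q.2) h)⁻¹}

/-- The algebra generated over the coordinate ring of `D(h)` by the coordinates `chowCoeff` with
degree in a given set. -/
def chowAlgebra (n : ℕ) (s : Set ℕ) : Subalgebra ℂ (BasicOpen n h → ℂ) :=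
  Algebra.adjoin ℂ (baseGenerators h n ∪
    {f | ∃ (j : Fin r) (μ : Fin n →₀ ℕ), μ.degree ∈ s ∧ f = fun ω => chowCoeff ω.1.1 ω.1.2 j μ})

/-- The coordinate ring of `D(h) × V^k`. -/
def pointAlgebra (n : ℕ) : Subalgebra ℂ (BasicOpen n h → ℂ) :=
  Algebra.adjoin ℂ (baseGenerators h n ∪
    Set.range fun q : Fin k × Fin n => fun ω => ω.1.2 q.1 q.2)

lemma chowAlgebra_mono {s t : Set ℕ} (hst : s ⊆ t) : chowAlgebra h n s ≤ chowAlgebra h n t := by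
  refine Algebra.adjoin_mono (Set.union_subset_union_right _ ?_)
  rintro _ ⟨j, μ, hμ, rfl⟩
  exact ⟨j, μ, hst hμ, rfl⟩

variable {h}

lemma weight_mem_baseGenerators (i : Fin k) (j : Fin r) :
    (fun ω => ω.1.1 i j) ∈ baseGenerators h n := Or.inl ⟨(i, j), rfl⟩

lemma chowAlgebra_le_pointAlgebra (s : Set ℕ) : chowAlgebra h n s ≤ pointAlgebra h n := by
  refine Algebra.adjoin_le ?_
  rintro _ (hf | ⟨j, μ, -, rfl⟩)
  · exact Algebra.subset_adjoin (Or.inl hf)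
  · exact chowCoeff_mem (fun i j => Algebra.subset_adjoin (Or.inl (weight_mem_baseGenerators i j)))
      (fun i l => Algebra.subset_adjoin (Or.inr ⟨(i, l), rfl⟩)) j μ

/-- Translates algebra membership into the fractions required by `IsStableLevel`, with powers of `h`
as common denominators. -/
lemma exists_eq_div_of_mem_chowAlgebra {N : ℕ} {f : BasicOpen n h → ℂ}
    (hf : f ∈ chowAlgebra h n (Set.Icc 1 N)) :
    ∃ (s : ℕ) (F : MvPolynomial ((Fin k × Fin r) ⊕ (Fin r × Exponents n N)) ℂ), ∀ ω,
      f ω = MvPolynomial.eval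
          (Sum.elim (fun q => ω.1.1 q.1 q.2) (fun q => chowCoords N ω.1.1 ω.1.2 q.1 q.2)) F /
        (MvPolynomial.eval (fun q => ω.1.1 q.1 q.2) h) ^ s := by
  have hren : ∀ (ω : BasicOpen n h), MvPolynomial.eval
      (Sum.elim (fun q => ω.1.1 q.1 q.2)
        (fun q : Fin r × Exponents n N => chowCoords N ω.1.1 ω.1.2 q.1 q.2))
      (MvPolynomial.rename Sum.inl h) = MvPolynomial.eval (fun q => ω.1.1 q.1 q.2) h :=
    fun ω => by rw [MvPolynomial.eval_rename]; rfl
  induction hf using Algebra.adjoin_induction with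
  | mem f hf =>
    rcases hf with (⟨q, rfl⟩ | rfl) | ⟨j, μ, hμ, rfl⟩
    · exact ⟨0, MvPolynomial.X (Sum.inl q), fun ω => by simp⟩
    · exact ⟨1, 1, fun ω => by simp⟩
    · exact ⟨0, MvPolynomial.X (Sum.inr (j, ⟨μ, hμ⟩)), fun ω => by simp [chowCoords]⟩
  | algebraMap c => exact ⟨0, MvPolynomial.C c, fun ω => by simp⟩
  | add f g _ _ hf hg =>
    obtain ⟨s, F, hF⟩ := hf
    obtain ⟨t, G, hG⟩ := hg
    refine ⟨s + t, F * MvPolynomial.rename Sum.inl h ^ t + G * MvPolynomial.rename Sum.inl h ^ s,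
      fun ω => ?_⟩
    have := ω.2
    simp only [Pi.add_apply, hF, hG, map_add, map_mul, map_pow, hren]
    field_simp
    ring
  | mul f g _ _ hf hg =>
    obtain ⟨s, F, hF⟩ := hf
    obtain ⟨t, G, hG⟩ := hg
    refine ⟨s + t, F * G, fun ω => ?_⟩
    simp only [Pi.mul_apply, hF, hG, map_mul, pow_add, div_mul_div_comm]

lemma isIntegral_point
    (hh : ∀ s : Finset (Fin k), s.Nonempty → ∃ j, (∑ i ∈ s, MvPolynomial.X (i, j)) ∣ h)
    (i : Fin k) (l : Fin n) :
    IsIntegral (chowAlgebra h n (Set.Ici 1)) (fun ω : BasicOpen n h => ω.1.2 i l) := by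
  have hbase : ∀ f ∈ baseGenerators h n, f ∈ chowAlgebra h n (Set.Ici 1) :=
    fun f hf => Algebra.subset_adjoin (Or.inl hf)
  let w : Fin k → Fin r → chowAlgebra h n (Set.Ici 1) :=
    fun i j => ⟨fun ω => ω.1.1 i j, hbase _ (weight_mem_baseGenerators i j)⟩
  have heval : ∀ p : MvPolynomial (Fin k × Fin r) ℂ, ∀ ω : BasicOpen n h,
      (MvPolynomial.aeval (fun q => w q.1 q.2) p : chowAlgebra h n (Set.Ici 1)).1 ω =
        MvPolynomial.eval (fun q => ω.1.1 q.1 q.2) p := by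
    intro p ω
    induction p using MvPolynomial.induction_on with
    | C a => simp
    | add p q hp hq => simp [← hp, ← hq]
    | mul_X p q hp => simp [← hp, w]
  refine isIntegral_of_pSum_mem w (fun s hs => ?_) 
    (fun i (ω : BasicOpen n h) => ω.1.2 i l) (fun q => ?_) i
  · obtain ⟨j, g, hg⟩ := hh s hs
    -- Since the subset sum times `g` is `h`, its inverse on `D(h)` is `g / h`.
    refine ⟨j, IsUnit.of_mul_eq_one (MvPolynomial.aeval (fun q => w q.1 q.2) g *
      ⟨_, hbase _ (Or.inr rfl)⟩) ?_⟩
    have hs : ∑ i ∈ s, w i j = MvPolynomial.aeval (fun q => w q.1 q.2)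
        (∑ i ∈ s, (MvPolynomial.X (i, j) : MvPolynomial (Fin k × Fin r) ℂ)) := by simp
    rw [hs, ← mul_assoc, ← map_mul, ← hg]
    ext ω
    exact (congrArg (· * (MvPolynomial.eval (fun q => ω.1.1 q.1 q.2) h)⁻¹) (heval h ω)).trans
      (mul_inv_cancel₀ ω.2)
  · refine ⟨⟨_, psum_mem (P := fun ω : BasicOpen n h => ω.1.1) (v := fun ω => ω.1.2)
      (fun j μ hμ => Algebra.subset_adjoin (Or.inr ⟨j, μ, hμ, rfl⟩)) q.2 l q.1⟩, ?_⟩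
    ext ω
    simp [genericPSum, w, Algebra.algebraMap_eq_smul_one, Subalgebra.smul_def]

/-- Artin-Tate: `pointAlgebra` is of finite type over `ℂ` and integral, hence finite, over
`chowAlgebra`. -/
lemma chowAlgebra_fg
    (hh : ∀ s : Finset (Fin k), s.Nonempty → ∃ j, (∑ i ∈ s, MvPolynomial.X (i, j)) ∣ h) :
    (chowAlgebra h n (Set.Ici 1)).FG := by
  let 𝒜 := chowAlgebra h n (Set.Ici 1)
  let ℬ := pointAlgebra h n
  have hle : 𝒜 ≤ ℬ := chowAlgebra_le_pointAlgebra _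
  let _ : Algebra 𝒜 ℬ := (Subalgebra.inclusion hle).toRingHom.toAlgebra
  have : IsScalarTower ℂ 𝒜 ℬ := IsScalarTower.of_algebraMap_eq fun _ => rfl
  have : IsScalarTower 𝒜 ℬ (BasicOpen n h → ℂ) := IsScalarTower.of_algebraMap_eq fun _ => rfl
  have hB : (⊤ : Subalgebra ℂ ℬ).FG := by
    rw [Subalgebra.fg_top]
    classical
    exact ⟨_, congrArg _ (Set.Finite.coe_toFinset (((Set.finite_range _).union
      (Set.finite_singleton _)).union (Set.finite_range _)))⟩
  have : Algebra.FiniteType ℂ ℬ := ⟨hB⟩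
  have : Algebra.FiniteType 𝒜 ℬ := .of_restrictScalars_finiteType ℂ _ _
  have hint : ∀ f ∈ ℬ, IsIntegral 𝒜 f := by
    have : ℬ ≤ (integralClosure 𝒜 (BasicOpen n h → ℂ)).restrictScalars ℂ := by
      refine Algebra.adjoin_le ?_
      rintro f (hf | ⟨q, rfl⟩)
      · exact isIntegral_algebraMap (x := (⟨f, Algebra.subset_adjoin (Or.inl hf)⟩ : 𝒜))
      · exact isIntegral_point hh q.1 q.2
    exact this
  have : Algebra.IsIntegral 𝒜 ℬ := ⟨fun f =>
    (isIntegral_algebraMap_iff (B := BasicOpen n h → ℂ) Subtype.val_injective).1 (hint f f.2)⟩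
  have hfin : Module.Finite 𝒜 ℬ := Algebra.IsIntegral.finite
  exact (Subalgebra.fg_top _).1
    (fg_of_fg_of_fg ℂ 𝒜 ℬ hB hfin.fg_top (Subalgebra.inclusion_injective hle))

/-- The algebra is the increasing union of its truncations, so one of them contains a finite
generating set. -/
lemma exists_chowAlgebra_le
    (hh : ∀ s : Finset (Fin k), s.Nonempty → ∃ j, (∑ i ∈ s, MvPolynomial.X (i, j)) ∣ h) :
    ∃ N, chowAlgebra h n (Set.Ici 1) ≤ chowAlgebra h n (Set.Icc 1 N) := by
  have hmono : ∀ {N M : ℕ}, N ≤ M →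
      chowAlgebra h n (Set.Icc 1 N) ≤ chowAlgebra h n (Set.Icc 1 M) :=
    fun hNM => chowAlgebra_mono h (Set.Icc_subset_Icc_right hNM)
  have hex : ∀ f ∈ chowAlgebra h n (Set.Ici 1), ∃ N, f ∈ chowAlgebra h n (Set.Icc 1 N) := by
    intro f hf
    induction hf using Algebra.adjoin_induction with
    | mem f hf =>
      rcases hf with hf | ⟨j, μ, hμ, rfl⟩
      · exact ⟨0, Algebra.subset_adjoin (Or.inl hf)⟩
      · exact ⟨μ.degree, Algebra.subset_adjoin (Or.inr ⟨j, μ, ⟨hμ, le_rfl⟩, rfl⟩)⟩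
    | algebraMap c => exact ⟨0, Subalgebra.algebraMap_mem _ c⟩
    | add f g _ _ hf hg =>
      obtain ⟨N, hN⟩ := hf
      obtain ⟨M, hM⟩ := hg
      exact ⟨max N M, add_mem (hmono (le_max_left _ _) hN) (hmono (le_max_right _ _) hM)⟩
    | mul f g _ _ hf hg =>
      obtain ⟨N, hN⟩ := hf
      obtain ⟨M, hM⟩ := hg
      exact ⟨max N M, mul_mem (hmono (le_max_left _ _) hN) (hmono (le_max_right _ _) hM)⟩
  obtain ⟨t, ht⟩ := chowAlgebra_fg (n := n) hh
  choose N hN using fun f : t => hex f (ht ▸ Algebra.subset_adjoin f.2)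
  refine ⟨univ.sup N, ?_⟩
  rw [← ht]
  exact Algebra.adjoin_le fun f hf => hmono (le_sup (mem_univ (⟨f, hf⟩ : t))) (hN ⟨f, hf⟩)

/-- A product of nonzero coordinates of the sums of all nonempty families of weights. -/
noncomputable def subsetSumProd (σ : {s : Finset (Fin k) // s.Nonempty} → Fin r) :
    MvPolynomial (Fin k × Fin r) ℂ :=
  ∏ s, ∑ i ∈ s.1, MvPolynomial.X (i, σ s)

lemma dvd_subsetSumProd (σ : {s : Finset (Fin k) // s.Nonempty} → Fin r)
    (s : Finset (Fin k)) (hs : s.Nonempty) :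
    ∃ j, (∑ i ∈ s, MvPolynomial.X (i, j)) ∣ subsetSumProd σ :=
  ⟨σ ⟨s, hs⟩, dvd_prod_of_mem (fun s : {s : Finset (Fin k) // s.Nonempty} =>
    ∑ i ∈ s.1, (MvPolynomial.X (i, σ s) : MvPolynomial (Fin k × Fin r) ℂ)) (mem_univ _)⟩

lemma eval_subsetSumProd (σ : {s : Finset (Fin k) // s.Nonempty} → Fin r)
    (P : Fin k → Fin r → ℂ) :
    MvPolynomial.eval (fun q => P q.1 q.2) (subsetSumProd σ) = ∏ s, (∑ i ∈ s.1, P i) (σ s) := by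
  simp [subsetSumProd]

/-- Let `σ` pick, for each nonempty subset, a coordinate where its sum at `P₀` is nonzero. Only
finitely many `σ` exist, so the maximum of their levels serves every `P₀`. -/
theorem exists_isStableLevel (k r n : ℕ) : ∃ N, IsStableLevel k r n N := by
  choose N hN using fun σ : {s : Finset (Fin k) // s.Nonempty} → Fin r =>
    exists_chowAlgebra_le (n := n) (dvd_subsetSumProd σ)
  refine ⟨univ.sup N, fun P₀ hP₀ => ?_⟩
  choose σ hσ using fun s : {s : Finset (Fin k) // s.Nonempty} =>
    Function.ne_iff.1 (hP₀ s.1 s.2)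
  refine ⟨subsetSumProd σ, ?_, ?_, ?_⟩
  · rw [eval_subsetSumProd]
    exact prod_ne_zero_iff.2 fun s _ => hσ s
  · intro P hP s hs h0
    rw [eval_subsetSumProd] at hP
    exact prod_ne_zero_iff.1 hP ⟨s, hs⟩ (mem_univ _) (by rw [h0]; rfl)
  · intro j μ hμ
    have hmem : (fun ω => chowCoeff ω.1.1 ω.1.2 j μ) ∈
        chowAlgebra (subsetSumProd σ) n (Set.Icc 1 (univ.sup N)) :=
      chowAlgebra_mono _ (Set.Icc_subset_Icc_right (le_sup (mem_univ σ)))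
        (hN σ (Algebra.subset_adjoin (Or.inr ⟨j, μ, hμ, rfl⟩)))
    obtain ⟨s, F, hF⟩ := exists_eq_div_of_mem_chowAlgebra hmem
    exact ⟨s, F, fun P hP v => hF ⟨(P, v), hP⟩⟩

end Stable

open Filter

/-! ### Fibres of the map -/

section Fibres

variable {k r n : ℕ}

/-- Grouping indices by position; `T` is left free so that two configurations can be compared over a
common set. -/
lemma sum_weight_smul {A : Type*} [AddCommGroup A] [Module ℂ A] {X : Type*}
    (P : Fin k → Fin r → ℂ) (x : Fin k → X) (j : Fin r) (f : X → A) {T : Finset X}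
    (hT : ∀ i, x i ∈ T) : ∑ i, P i j • f (x i) = ∑ p ∈ T, weightAt P x p j • f p := by
  classical
  rw [← sum_fiberwise_of_maps_to (fun i _ => hT i)]
  refine sum_congr rfl fun p _ => ?_
  rw [weightAt, Finset.sum_apply, sum_smul]
  refine sum_congr (by ext; simp) fun i hi => ?_
  rw [(mem_filter.1 hi).2]

lemma chowCoeff_congr {P : Fin k → Fin r → ℂ} {v v' : Fin k → Fin n → ℂ}
    (h : ∀ p, weightAt P v p = weightAt P v' p) (j : Fin r) (μ : Fin n →₀ ℕ) :
    chowCoeff P v j μ = chowCoeff P v' j μ := by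
  classical
  rw [chowCoeff, chowCoeff, weightedESymm_congr fun d => ?_]
  have hT := fun i => mem_union_left (univ.image v') (mem_image_of_mem v (mem_univ i))
  have hT' := fun i => mem_union_right (univ.image v) (mem_image_of_mem v' (mem_univ i))
  have h1 := sum_weight_smul P v j (fun p => linForm p ^ (d + 1)) hT
  have h2 := sum_weight_smul P v' j (fun p => linForm p ^ (d + 1)) hT'
  simp only [h] at h1
  exact h1.trans h2.symm

/-- Give the points of `v` weights `P` and those of `v'` weights `-P`. All power sums of the union
vanish: in positive degree by Newton, in degree zero because the weights cancel. -/
lemma weightAt_congr {P : Fin k → Fin r → ℂ} {v v' : Fin k → Fin n → ℂ}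
    (h : ∀ j (μ : Fin n →₀ ℕ), 1 ≤ μ.degree → chowCoeff P v j μ = chowCoeff P v' j μ)
    (p : Fin n → ℂ) : weightAt P v p = weightAt P v' p := by
  classical
  ext j
  have hp := weightedPSum_congr (y := fun i => P i j) (y' := fun i => P i j)
    (x := fun i => linForm (v i)) (x' := fun i => linForm (v' i)) fun d => by
      ext μ
      simp only [coeff_weightedESymm]
      split_ifs with hd
      · rw [h j μ (by omega)]
      · rfl
  have hs := sum_weights_eq_zero
    (Sum.elim (fun i => (MvPolynomial.C (P i j) : MvPolynomial (Fin n) ℂ))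
      fun i => -MvPolynomial.C (P i j))
    (Sum.elim (fun i => linForm (v i)) fun i => linForm (v' i)) (fun d => by
      rw [Fintype.sum_sum_type]
      obtain _ | d := d
      · simp
      · have := hp d
        simp only [weightedPSum, MvPolynomial.smul_eq_C_mul] at this
        simp [this]) (linForm p)
  rw [sum_filter, Fintype.sum_sum_type] at hs
  simp only [Sum.elim_inl, Sum.elim_inr, linForm_injective.eq_iff] at hs
  rw [← sum_filter, ← sum_filter, sum_neg_distrib, ← map_sum, ← map_sum, ← sub_eq_add_neg,
    sub_eq_zero] at hs
  have := MvPolynomial.C_injective _ _ hs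
  simp only [weightAt, Finset.sum_apply]
  convert this

lemma weightAt_coe {X : Set (Fin n → ℂ)} (P : Fin k → Fin r → ℂ) (x : Fin k → X) (p : X) :
    weightAt P (fun i => (x i : Fin n → ℂ)) p = weightAt P x p := by
  exact sum_congr (by ext; simp [Subtype.ext_iff]) fun _ _ => rfl

lemma weightAt_eq_zero {X : Type*} (P : Fin k → Fin r → ℂ) {x : Fin k → X} {p : X}
    (h : ∀ i, x i ≠ p) : weightAt P x p = 0 := by
  classical
  exact sum_eq_zero fun i hi => absurd (mem_filter.1 hi).2 (h i)

lemma weightAt_coe_eq_zero {X : Set (Fin n → ℂ)} (P : Fin k → Fin r → ℂ) (x : Fin k → X)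
    {p : Fin n → ℂ} (hp : p ∉ X) : weightAt P (fun i => (x i : Fin n → ℂ)) p = 0 :=
  weightAt_eq_zero P fun i hi => hp (hi ▸ (x i).2)

lemma IsStableLevel.chowCoeff_eq {N : ℕ} (hN : IsStableLevel k r n N) {P : Fin k → Fin r → ℂ}
    (hP : P ∈ weightSpace k r) {v v' : Fin k → Fin n → ℂ}
    (h : chowCoords N P v = chowCoords N P v') (j : Fin r) (μ : Fin n →₀ ℕ)
    (hμ : 1 ≤ μ.degree) : chowCoeff P v j μ = chowCoeff P v' j μ := by
  obtain ⟨g, hg, -, hF⟩ := hN P hP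
  obtain ⟨s, F, hF⟩ := hF j μ hμ
  rw [hF P hg v, hF P hg v', h]

/-- The fibres of `chowMap` are the equivalence classes of configurations. -/
lemma chowMap_eq_iff {N : ℕ} (hN : IsStableLevel k r n N) {X : Set (Fin n → ℂ)}
    (a b : weightSpace k r × (Fin k → X)) :
    chowMap k r N X a = chowMap k r N X b ↔ configSetoid k r X a b := by
  obtain ⟨P, x⟩ := a
  obtain ⟨P', x'⟩ := b
  refine ⟨fun h => ?_, fun ⟨h1, h2⟩ => ?_⟩
  · obtain rfl : P = P' := congrArg Prod.fst h
    refine ⟨rfl, fun p => ?_⟩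
    have := weightAt_congr (hN.chowCoeff_eq P.2 (congrArg Prod.snd h)) p
    rwa [weightAt_coe, weightAt_coe] at this
  · obtain rfl : P = P' := h1
    refine Prod.ext rfl ?_
    ext j μ
    refine chowCoeff_congr (fun p => ?_) j μ.1
    -- The equivalence tests only points of `X`; elsewhere both weights vanish.
    by_cases hp : p ∈ X
    · exact (weightAt_coe P.1 x ⟨p, hp⟩).trans ((h2 ⟨p, hp⟩).trans (weightAt_coe P.1 x' _).symm)
    · rw [weightAt_coe_eq_zero _ _ hp, weightAt_coe_eq_zero _ _ hp]

lemma chowCoords_smul (N : ℕ) (P : Fin k → Fin r → ℂ) (v : Fin k → Fin n → ℂ) (c : ℂ)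
    (j : Fin r) (μ : Exponents n N) :
    chowCoords N P (c • v) j μ = c ^ μ.1.degree * chowCoords N P v j μ := by
  have : (fun i => linForm ((c • v) i)) = fun i => c • linForm (v i) :=
    funext fun i => linForm_smul c (v i)
  rw [chowCoords, chowCoords, chowCoeff, this, weightedESymm_smul, MvPolynomial.coeff_smul,
    chowCoeff, smul_eq_mul]
  ring

/-- Over allowable weights only the zero configuration has all coordinates zero. -/
lemma IsStableLevel.eq_zero {N : ℕ} (hN : IsStableLevel k r n N) {P : Fin k → Fin r → ℂ}
    (hP : P ∈ weightSpace k r) {v : Fin k → Fin n → ℂ}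
    (h : chowCoords N P v = 0) : v = 0 := by
  classical
  have h0 : chowCoords N P (0 : Fin k → Fin n → ℂ) = 0 := by
    ext j μ
    have hμ : μ.1.degree ≠ 0 := (Nat.one_le_iff_ne_zero.1 μ.2.1)
    have := chowCoords_smul N P (0 : Fin k → Fin n → ℂ) 0 j μ
    rwa [smul_zero, zero_pow hμ, zero_mul] at this
  have hw := weightAt_congr (hN.chowCoeff_eq hP (h.trans h0.symm))
  by_contra hv
  obtain ⟨i, hi⟩ := Function.ne_iff.1 hv
  -- The zero configuration carries no weight at the nonzero point `v i`, so the family sitting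
  -- there would sum to zero.
  refine hP {i' | v i' = v i} ⟨i, by simp⟩ ?_
  have h1 : weightAt P 0 (v i) = 0 :=
    weightAt_eq_zero P fun _ h' => hi h'.symm
  rw [← hw, weightAt] at h1
  convert h1

end Fibres

/-! ### Continuity and properness -/

section Topology

variable {k r n : ℕ}

lemma continuous_chowCoords {Ω : Type*} [TopologicalSpace Ω] (N : ℕ)
    {P : Ω → Fin k → Fin r → ℂ} {v : Ω → Fin k → Fin n → ℂ} (hP : Continuous P)
    (hv : Continuous v) : Continuous fun ω => chowCoords N (P ω) (v ω) := by
  -- Continuous functions form a subalgebra, so `chowCoeff_mem` yields continuity.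
  let S : Subalgebra ℂ (Ω → ℂ) :=
    { carrier := {f | Continuous f}
      mul_mem' := fun hf hg => Continuous.mul hf hg
      add_mem' := fun hf hg => Continuous.add hf hg
      algebraMap_mem' := fun _ => continuous_const }
  refine continuous_pi fun j => continuous_pi fun μ => ?_
  exact chowCoeff_mem (S := S) (fun i j => show Continuous _ by fun_prop)
    (fun i l => show Continuous _ by fun_prop) j μ.1

lemma tendsto_chowCoords {Ω : Type*} {l : Filter Ω} (N : ℕ)
    {P : Ω → Fin k → Fin r → ℂ} {v : Ω → Fin k → Fin n → ℂ} {P₀ : Fin k → Fin r → ℂ}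
    {v₀ : Fin k → Fin n → ℂ} (hP : Tendsto P l (𝓝 P₀)) (hv : Tendsto v l (𝓝 v₀)) :
    Tendsto (fun ω => chowCoords N (P ω) (v ω)) l (𝓝 (chowCoords N P₀ v₀)) := by
  have h1 : Continuous fun q : (Fin k → Fin r → ℂ) × (Fin k → Fin n → ℂ) => q.1 := continuous_fst
  have h2 : Continuous fun q : (Fin k → Fin r → ℂ) × (Fin k → Fin n → ℂ) => q.2 := continuous_snd
  have h := continuous_chowCoords N h1 h2
  have h' := (h.tendsto (P₀, v₀)).comp (hP.prodMk_nhds hv)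
  simpa only [Function.comp_def] using h'

lemma continuous_chowMap (N : ℕ) (X : Set (Fin n → ℂ)) : Continuous (chowMap k r N X) :=
  continuous_fst.prodMk (continuous_chowCoords N (by fun_prop) (by fun_prop))

/-- Along an ultrafilter on which the weights converge to allowable weights and the coordinates
converge, the points stay bounded. -/
lemma IsStableLevel.eventually_norm_le {N : ℕ} (hN : IsStableLevel k r n N) {Ω : Type*}
    {U : Ultrafilter Ω} {P : Ω → Fin k → Fin r → ℂ} {v : Ω → Fin k → Fin n → ℂ}
    {P₀ : Fin k → Fin r → ℂ} (hP₀ : P₀ ∈ weightSpace k r) (hP : Tendsto P U (𝓝 P₀))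
    {e : Fin r → Exponents n N → ℂ} (he : Tendsto (fun ω => chowCoords N (P ω) (v ω)) U (𝓝 e)) :
    ∃ R : ℝ, ∀ᶠ ω in U, ‖v ω‖ ≤ R := by
  by_contra! hR
  have htop : Tendsto (fun ω => ‖v ω‖) U atTop :=
    tendsto_atTop.2 fun R => (hR R).mono fun _ h => h.le
  -- Rescaling to norm one; the value of `c` where `v ω = 0` is irrelevant, since the norms tend to
  -- infinity.
  obtain ⟨c, hc_norm⟩ : ∃ c : Ω → ℂ, ∀ ω, ‖c ω‖ = ‖v ω‖⁻¹ :=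
    ⟨fun ω => ((‖v ω‖⁻¹ : ℝ) : ℂ), fun ω => by simp⟩
  have hc : Tendsto c U (𝓝 0) := by
    rw [tendsto_zero_iff_norm_tendsto_zero]
    simpa only [hc_norm] using! tendsto_inv_atTop_zero.comp htop
  have hu : ∀ᶠ ω in U, c ω • v ω ∈ Metric.sphere (0 : Fin k → Fin n → ℂ) 1 := by
    filter_upwards [hR 0] with ω hω
    rw [mem_sphere_zero_iff_norm, norm_smul, hc_norm,
      inv_mul_cancel₀ hω.ne']
  obtain ⟨u, hu1, hu⟩ := (isCompact_sphere (0 : Fin k → Fin n → ℂ) 1).ultrafilter_le_nhds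
    (U.map fun ω => c ω • v ω) (le_principal_iff.2 hu)
  have hu : Tendsto (fun ω => c ω • v ω) U (𝓝 u) := hu
  have hzero : chowCoords N P₀ u = 0 := by
    ext j μ
    have h1 : Tendsto (fun ω => chowCoords N (P ω) (c ω • v ω) j μ) U
        (𝓝 (chowCoords N P₀ u j μ)) :=
      tendsto_pi_nhds.1 (tendsto_pi_nhds.1 (tendsto_chowCoords N hP hu) j) μ
    have h2 : Tendsto (fun ω => chowCoords N (P ω) (v ω) j μ) U (𝓝 (e j μ)) :=
      tendsto_pi_nhds.1 (tendsto_pi_nhds.1 he j) μ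
    -- A coordinate of positive degree is scaled by a positive power of `c`, which tends to zero,
    -- while the unscaled coordinate converges.
    have h3 := (hc.pow μ.1.degree).mul h2
    rw [zero_pow (Nat.one_le_iff_ne_zero.1 μ.2.1), zero_mul] at h3
    simp only [chowCoords_smul] at h1
    exact tendsto_nhds_unique h1 h3
  rw [hN.eq_zero hP₀ hzero] at hu1
  simp at hu1

/-- Convergence of the images bounds the points, and bounded closed subsets of `X^k` are compact
because `X` is closed. -/
lemma isProperMap_chowMap {N : ℕ} (hN : IsStableLevel k r n N) {X : Set (Fin n → ℂ)}
    (hX : IsClosed X) : IsProperMap (chowMap k r N X) := by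
  rw [isProperMap_iff_ultrafilter]
  refine ⟨continuous_chowMap N X, fun U y hU => ?_⟩
  have h1 : Tendsto (fun c : weightSpace k r × (Fin k → X) => c.1) U (𝓝 y.1) :=
    (continuous_fst.tendsto y).comp hU
  have h2 : Tendsto (fun c => (chowMap k r N X c).2) U (𝓝 y.2) :=
    (continuous_snd.tendsto y).comp hU
  obtain ⟨R, hR⟩ := hN.eventually_norm_le y.1.2
    ((continuous_subtype_val.tendsto y.1).comp h1) h2
  have hemb : IsClosedEmbedding fun (x : Fin k → X) i => (x i : Fin n → ℂ) :=
    IsClosedEmbedding.piMap fun _ => hX.isClosedEmbedding_subtypeVal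
  have hK := hemb.isCompact_preimage (isCompact_closedBall (0 : Fin k → Fin n → ℂ) R)
  obtain ⟨x, -, hx⟩ := hK.ultrafilter_le_nhds (U.map Prod.snd)
    (le_principal_iff.2 (hR.mono fun c hc => mem_closedBall_zero_iff.2 hc))
  have hx : Tendsto Prod.snd (U : Filter (weightSpace k r × (Fin k → X))) (𝓝 x) := hx
  have hlim : Tendsto id (U : Filter (weightSpace k r × (Fin k → X))) (𝓝 (y.1, x)) :=
    h1.prodMk_nhds hx
  exact ⟨(y.1, x), tendsto_nhds_unique (((continuous_chowMap N X).tendsto _).comp hlim) hU, hlim⟩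

lemma IsAffineVariety.isClosed {X : Set (Fin n → ℂ)} (hX : IsAffineVariety X) : IsClosed X := by
  obtain ⟨I, rfl⟩ := hX
  have : MvPolynomial.zeroLocus ℂ I = ⋂ p ∈ I, {x | MvPolynomial.aeval x p = 0} := by
    ext x; simp [MvPolynomial.mem_zeroLocus_iff]
  rw [this]
  refine isClosed_biInter fun p _ => isClosed_eq ?_ continuous_const
  simpa only [MvPolynomial.aeval_eq_eval] using! MvPolynomial.continuous_eval p

end Topology

end IncidenceStrata

theorem mainTheorem6 (k r n : ℕ) :
    (∃ N : ℕ, IncidenceStrata.IsStableLevel k r n N) ∧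
    ∀ N : ℕ, IncidenceStrata.IsStableLevel k r n N →
      ∀ X : Set (Fin n → ℂ), IncidenceStrata.IsAffineVariety X →
        ∃ φ : IncidenceStrata.WeightedConfigSpace k r X ≃ₜ IncidenceStrata.Delta k r N X,
          ∀ c : IncidenceStrata.weightSpace k r × (Fin k → X),
            ((φ (Quotient.mk (IncidenceStrata.configSetoid k r X) c) :
                IncidenceStrata.Delta k r N X) :
              IncidenceStrata.weightSpace k r ×
                (Fin r → IncidenceStrata.Exponents n N → ℂ)) =
              IncidenceStrata.chowMap k r N X c := by
  refine ⟨IncidenceStrata.exists_isStableLevel k r n, fun N hN X hX => ?_⟩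
  let f : IncidenceStrata.weightSpace k r × (Fin k → X) → IncidenceStrata.Delta k r N X :=
    Set.rangeFactorization (IncidenceStrata.chowMap k r N X)
  have hf : ∀ a b, f a = f b ↔ IncidenceStrata.configSetoid k r X a b := fun a b =>
    Subtype.ext_iff.trans (IncidenceStrata.chowMap_eq_iff hN a b)
  have hcont : Continuous f := (IncidenceStrata.continuous_chowMap N X).subtype_mk _
  have hclosed : IsClosedMap f :=
    -- Properness descends to the map onto the image because the inclusion of the image is
    -- injective.
    (isProperMap_of_comp_of_inj hcont continuous_subtype_val
      (IncidenceStrata.isProperMap_chowMap hN hX.isClosed) Subtype.val_injective).isClosedMap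
  let g : IncidenceStrata.WeightedConfigSpace k r X → IncidenceStrata.Delta k r N X :=
    Quotient.lift f fun a b h => (hf a b).2 h
  have hg : Function.Bijective g := by
    constructor
    · rintro ⟨a⟩ ⟨b⟩ h
      exact Quotient.sound ((hf a b).1 h)
    · rintro ⟨_, c, rfl⟩
      exact ⟨Quotient.mk _ c, rfl⟩
  refine ⟨(Equiv.ofBijective g hg).toHomeomorphOfContinuousClosed (hcont.quotient_lift _) ?_,
    fun c => rfl⟩
  intro C hC
  have : g '' C = f '' (Quotient.mk _ ⁻¹' C) := by
    rw [← Set.image_preimage_eq C Quotient.mk_surjective, ← Set.image_comp,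
      Set.image_preimage_eq C Quotient.mk_surjective]
    rfl
  exact (this ▸ hclosed _ (hC.preimage continuous_quotient_mk') : IsClosed (g '' C))
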